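/- Fix a finite nonempty set $\mathsf{Ag}$ of agents and a countably infinite set $\mathsf{Prop}$ of propositional variables; a group is a nonempty subset of $\mathsf{Ag}$. The language $\mathcal{EL}$ has the formulas $\phi ::= p \mid \neg\phi \mid (\phi\to\phi) \mid K_a\phi$ with $p\in\mathsf{Prop}$, $a\in\mathsf{Ag}$; the language $\mathcal{ELC}$ adds formulas $C_G\phi$, $\mathcal{ELD}$ adds formulas $D_G\phi$, and $\mathcal{ELCD}$ adds both, for groups $G$. Put $E_G\phi := \bigwedge_{a\in G}K_a\phi$, $E_G^1\phi := E_G\phi$, $E_G^{n+1}\phi := E_GE_G^n\phi$. A model is a tuple $M=(W,A,E,C,\nu)$ with a nonempty set $W$ of states, a set $A$ (possibly empty) of abilities, $E:W\times W\to\wp(A)$, $C:\mathsf{Ag}\to\wp(A)$ and $\nu:W\to\wp(\mathsf{Prop})$. It is symmetric if $E(s,t)=E(t,s)$ for all $s,t\in W$. Truth at a state is defined by: $M,s\models p$ iff $p\in\nu(s)$; $\neg$ and $\to$ are classical; $M,s\models K_a\psi$ iff $M,t\models\psi$ for all $t$ with $C(a)\subseteq E(s,t)$; $M,s\models C_G\psi$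 iff $M,s\models E_G^n\psi$ for all $n\ge 1$; $M,s\models D_G\psi$ iff $M,t\models\psi$ for all $t$ with $\bigcup_{a\in G}C(a)\subseteq E(s,t)$. For a class $\mathcal M$ of models, $\Phi\models_{\mathcal M}\phi$ means that at every state of every model in $\mathcal M$ where all formulas of $\Phi$ are true, $\phi$ is true; and $\phi$ is valid over $\mathcal M$ if $\emptyset\models_{\mathcal M}\phi$. The system $\mathbf K$ has as axioms all instances of propositional tautologies and $K_a(\phi\to\psi)\to(K_a\phi\to K_a\psi)$, and as rules modus ponens (from $\phi$ and $\phi\to\psi$ infer $\psi$) and necessitation (from $\phi$ infer $K_a\phi$). $\mathbf{KB}$ adds to $\mathbf K$ the axiom $\phi\to K_a\neg K_a\neg\phi$. $\mathbf{K(C)}$ adds to $\mathbf K$ the axiom $C_G\phi\to E_G(\phi\wedge C_G\phi)$ and the rule: from $\phi\to E_G(\phi\wedge\psi)$ infer $\phi\to C_G\psi$. $\mathbf{K(D)}$ adds to $\mathbf K$ the axioms $D_G(\phi\to\psi)\to(D_G\phi\to D_G\psi)$, $D_{\{a\}}\phi\leftrightarrow K_a\phi$, and $D_G\phi\to D_H\phi$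 for $G\subseteq H$. $\mathbf{K(CD)}$ adds both sets of axioms and rules to $\mathbf K$. The systems $\mathbf K$ and $\mathbf{KB}$ are used over the language $\mathcal{EL}$, and $\mathbf{K(C)}$, $\mathbf{K(D)}$, $\mathbf{K(CD)}$ over $\mathcal{ELC}$, $\mathcal{ELD}$, $\mathcal{ELCD}$, respectively. $\vdash_\Lambda\phi$ means that $\phi$ is a theorem of the system $\Lambda$, and $\Phi\vdash_\Lambda\phi$ means that there are $n\ge 0$ and $\psi_1,\dots,\psi_n\in\Phi$ with $\vdash_\Lambda\psi_1\to(\cdots\to(\psi_n\to\phi))$. Theorem. The following hold. 1. $\mathbf K$ is strongly complete for $\mathrm{EL}$: for every set $\Phi$ of $\mathcal{EL}$-formulas and every $\mathcal{EL}$-formula $\phi$, if $\Phi\models\phi$ over the class of all models, then $\Phi\vdash_{\mathbf K}\phi$. 2. $\mathbf{K(C)}$ is weakly complete for $\mathrm{ELC}$: every $\mathcal{ELC}$-formula $\phi$ that is valid over the class of all models satisfies $\vdash_{\mathbf{K(C)}}\phi$. 3. $\mathbf{K(D)}$ is strongly complete for $\mathrm{ELD}$: for every set $\Phi$ of $\mathcal{ELD}$-formulas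 and every $\mathcal{ELD}$-formula $\phi$, if $\Phi\models\phi$ over the class of all models, then $\Phi\vdash_{\mathbf{K(D)}}\phi$. 4. $\mathbf{K(CD)}$ is weakly complete for $\mathrm{ELCD}$: every $\mathcal{ELCD}$-formula $\phi$ that is valid over the class of all models satisfies $\vdash_{\mathbf{K(CD)}}\phi$. 5. $\mathbf{KB}$ is strongly complete with respect to the class of all symmetric models: for every set $\Phi$ of $\mathcal{EL}$-formulas and every $\mathcal{EL}$-formula $\phi$, if $\Phi\models\phi$ over the class of all symmetric models, then $\Phi\vdash_{\mathbf{KB}}\phi$. -/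

import Mathlib

universe u

namespace WeightedEL

/-! ### Languages -/

/-- Selects one of the languages `EL`, `ELC`, `ELD`, `ELCD`: which group modalities are present. -/
structure Lang where
  hasC : Bool
  hasD : Bool

abbrev EL : Lang := ⟨false, false⟩
abbrev ELC : Lang := ⟨true, false⟩
abbrev ELD : Lang := ⟨false, true⟩
abbrev ELCD : Lang := ⟨true, true⟩

/-- A group: a nonempty subset of the (finite) set of agents. -/
abbrev AgentGroup (Ag : Type u) : Type u := {G : Finset Ag // G.Nonempty}

/-- The group `{a}`. -/
def AgentGroup.single {Ag : Type u} (a : Ag) : AgentGroup Ag := ⟨{a}, Finset.singleton_nonempty a⟩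

/-- Formulas of the language `L` over the agents `Ag` and the propositional variables `P`. The
modalities `C_G` and `D_G` may be used only if `L` has them. -/
inductive Formula (L : Lang) (Ag P : Type u) : Type u
  | atom (p : P) : Formula L Ag P
  | neg (φ : Formula L Ag P) : Formula L Ag P
  | imp (φ ψ : Formula L Ag P) : Formula L Ag P
  | know (a : Ag) (φ : Formula L Ag P) : Formula L Ag P
  | common (hC : L.hasC = true) (G : AgentGroup Ag) (φ : Formula L Ag P) : Formula L Ag P
  | dist (hD : L.hasD = true) (G : AgentGroup Ag) (φ : Formula L Ag P) : Formula L Ag P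

namespace Formula

variable {L : Lang} {Ag P : Type u}

def conj (φ ψ : Formula L Ag P) : Formula L Ag P := neg (imp φ (neg ψ))

def iff (φ ψ : Formula L Ag P) : Formula L Ag P := conj (imp φ ψ) (imp ψ φ)

/-- The conjunction of a nonempty list of formulas, given by its head and its tail. -/
def bigConj : Formula L Ag P → List (Formula L Ag P) → Formula L Ag P
  | φ, [] => φ
  | φ, ψ :: l => conj φ (bigConj ψ l)

/-- The members of a group, in some fixed order. -/
noncomputable def members (G : AgentGroup Ag) : List Ag := G.1.toList

theorem members_ne_nil (G : AgentGroup Ag) : members G ≠ [] := by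
  simpa [members] using G.2.ne_empty

/-- `E_G φ`, the conjunction of the formulas `K_a φ` over `a ∈ G`. -/
noncomputable def everyone (G : AgentGroup Ag) (φ : Formula L Ag P) : Formula L Ag P :=
  bigConj (know ((members G).head (members_ne_nil G)) φ)
    ((members G).tail.map fun a => know a φ)

/-- `E_G^n φ` (with `E_G^0 φ = φ`). -/
noncomputable def everyonePow (G : AgentGroup Ag) : ℕ → Formula L Ag P → Formula L Ag P
  | 0, φ => φ
  | n + 1, φ => everyone G (everyonePow G n φ)

end Formula

/-! ### Weighted models -/

/-- A model `(W, A, E, C, ν)` on a weighted graph `(W, A, E)`. -/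
structure Model (Ag P : Type u) where
  W : Type u
  nonempty : Nonempty W
  A : Type u
  E : W → W → Set A
  C : Ag → Set A
  ν : W → Set P

namespace Model

variable {L : Lang} {Ag P : Type u}

/-- A symmetric model. -/
def IsSymmetric (M : Model Ag P) : Prop := ∀ s t : M.W, M.E s t = M.E t s

/-- The set of the states at which every member of `G` knows the proposition `X`. -/
def everyoneKnows (M : Model Ag P) (G : AgentGroup Ag) (X : M.W → Prop) : M.W → Prop :=
  fun s => ∀ a ∈ G.1, ∀ t, M.C a ⊆ M.E s t → X t

/-- `M.Sat φ s` is `M, s ⊨ φ`. In the clause for `C_G ψ`, the condition for all `n ≥ 1` is that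
`E_G^n ψ` is true at `s`, see `Model.sat_common_iff`. -/
def Sat (M : Model Ag P) : Formula L Ag P → M.W → Prop
  | .atom p, s => p ∈ M.ν s
  | .neg φ, s => ¬ M.Sat φ s
  | .imp φ ψ, s => M.Sat φ s → M.Sat ψ s
  | .know a φ, s => ∀ t, M.C a ⊆ M.E s t → M.Sat φ t
  | .common _ G φ, s => ∀ n : ℕ, 1 ≤ n → ((M.everyoneKnows G)^[n] (M.Sat φ)) s
  | .dist _ G φ, s => ∀ t, (⋃ a ∈ G.1, M.C a) ⊆ M.E s t → M.Sat φ t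

theorem sat_conj (M : Model Ag P) (φ ψ : Formula L Ag P) (s : M.W) :
    M.Sat (φ.conj ψ) s ↔ M.Sat φ s ∧ M.Sat ψ s := by
  simp only [Formula.conj, Sat]; tauto

theorem sat_bigConj (M : Model Ag P) (φ : Formula L Ag P) (l : List (Formula L Ag P)) (s : M.W) :
    M.Sat (Formula.bigConj φ l) s ↔ ∀ ψ ∈ φ :: l, M.Sat ψ s := by
  induction l generalizing φ with
  | nil => simp [Formula.bigConj]
  | cons ψ l ih => simp [Formula.bigConj, sat_conj, ih]

theorem sat_everyone (M : Model Ag P) (G : AgentGroup Ag) (φ : Formula L Ag P) (s : M.W) :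
    M.Sat (φ.everyone G) s ↔ ∀ a ∈ G.1, M.Sat (.know a φ) s := by
  have h : (Formula.members G).head (Formula.members_ne_nil G) :: (Formula.members G).tail =
      Formula.members G := List.cons_head_tail _
  rw [Formula.everyone, sat_bigConj, ← List.map_cons (f := fun a => Formula.know a φ), h]
  simp [Formula.members]

theorem sat_everyonePow (M : Model Ag P) (G : AgentGroup Ag) (φ : Formula L Ag P) (n : ℕ) :
    M.Sat (φ.everyonePow G n) = (M.everyoneKnows G)^[n] (M.Sat φ) := by
  induction n with
  | zero => rfl
  | succ n ih =>
    rw [Function.iterate_succ_apply', ← ih]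
    funext s
    simp only [Formula.everyonePow, sat_everyone, Sat, everyoneKnows]

theorem sat_common_iff (M : Model Ag P) (hC : L.hasC = true) (G : AgentGroup Ag)
    (φ : Formula L Ag P) (s : M.W) :
    M.Sat (.common hC G φ) s ↔ ∀ n : ℕ, 1 ≤ n → M.Sat (φ.everyonePow G n) s := by
  simp only [Sat, sat_everyonePow]

end Model

/-! ### Propositional tautologies and their instances -/

/-- Formulas of propositional logic. -/
inductive PropFormula (α : Type u) : Type u
  | var (x : α) : PropFormula α
  | neg (π : PropFormula α) : PropFormula α
  | imp (π ρ : PropFormula α) : PropFormula α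

namespace PropFormula

def eval {α : Type u} (v : α → Prop) : PropFormula α → Prop
  | var x => v x
  | neg π => ¬ eval v π
  | imp π ρ => eval v π → eval v ρ

def IsTautology {α : Type u} (π : PropFormula α) : Prop := ∀ v : α → Prop, π.eval v

variable {L : Lang} {Ag P : Type u}

def subst {α : Type} (σ : α → Formula L Ag P) : PropFormula α → Formula L Ag P
  | var x => σ x
  | neg π => .neg (subst σ π)
  | imp π ρ => .imp (subst σ π) (subst σ ρ)

end PropFormula

/-- `φ` arises from a propositional tautology by substituting formulas for its letters. -/
def IsTautologyInstance {L : Lang} {Ag P : Type u} (φ : Formula L Ag P) : Prop :=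
  ∃ (π : PropFormula ℕ) (σ : ℕ → Formula L Ag P), π.IsTautology ∧ π.subst σ = φ

/-! ### Axiomatic systems -/

/-- The base of an axiomatic system: `K` or `KB`. -/
inductive Base
  | K
  | KB

open Formula in
/-- `Provable b φ`, for a formula `φ` of the language `L`: the formula `φ` is a theorem of the
axiomatic system with base `b` for that language. For the base `K` this is the system `K`, `K(C)`,
`K(D)` or `K(CD)` if `L` is `EL`, `ELC`, `ELD` or `ELCD`; likewise for the base `KB`. -/
inductive Provable {L : Lang} {Ag P : Type u} (b : Base) : Formula L Ag P → Prop
  | PC (φ : Formula L Ag P) : IsTautologyInstance φ → Provable b φ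
  | axK (a : Ag) (φ ψ : Formula L Ag P) :
      Provable b (imp (know a (imp φ ψ)) (imp (know a φ) (know a ψ)))
  | axB (hb : b = .KB) (a : Ag) (φ : Formula L Ag P) :
      Provable b (imp φ (know a (neg (know a (neg φ)))))
  | MP (φ ψ : Formula L Ag P) : Provable b φ → Provable b (imp φ ψ) → Provable b ψ
  | N (a : Ag) (φ : Formula L Ag P) : Provable b φ → Provable b (know a φ)
  | C1 (hC : L.hasC = true) (G : AgentGroup Ag) (φ : Formula L Ag P) :
      Provable b (imp (common hC G φ) (everyone G (conj φ (common hC G φ))))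
  | C2 (hC : L.hasC = true) (G : AgentGroup Ag) (φ ψ : Formula L Ag P) :
      Provable b (imp φ (everyone G (conj φ ψ))) → Provable b (imp φ (common hC G ψ))
  | KD (hD : L.hasD = true) (G : AgentGroup Ag) (φ ψ : Formula L Ag P) :
      Provable b (imp (dist hD G (imp φ ψ)) (imp (dist hD G φ) (dist hD G ψ)))
  | D1 (hD : L.hasD = true) (a : Ag) (φ : Formula L Ag P) :
      Provable b (iff (dist hD (AgentGroup.single a) φ) (know a φ))
  | D2 (hD : L.hasD = true) (G H : AgentGroup Ag) (hGH : G.1 ⊆ H.1) (φ : Formula L Ag P) :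
      Provable b (imp (dist hD G φ) (dist hD H φ))
  | BD (hb : b = .KB) (hD : L.hasD = true) (G : AgentGroup Ag) (φ : Formula L Ag P) :
      Provable b (imp φ (dist hD G (neg (dist hD G (neg φ)))))

/-- `Φ ⊢ φ`: there are `ψ₁, …, ψₙ ∈ Φ`, `n ≥ 0`, such that `ψ₁ → (⋯ → (ψₙ → φ))` is a theorem. -/
def Derivable {L : Lang} {Ag P : Type u} (b : Base) (Φ : Set (Formula L Ag P))
    (φ : Formula L Ag P) : Prop :=
  ∃ l : List (Formula L Ag P), (∀ ψ ∈ l, ψ ∈ Φ) ∧ Provable b (l.foldr Formula.imp φ)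

/-! ### Logical consequence and completeness -/

/-- `Φ ⊨ φ` over the class `𝓜` of models. -/
def Entails {L : Lang} {Ag P : Type u} (𝓜 : Set (Model Ag P)) (Φ : Set (Formula L Ag P))
    (φ : Formula L Ag P) : Prop :=
  ∀ M ∈ 𝓜, ∀ s : M.W, (∀ ψ ∈ Φ, M.Sat ψ s) → M.Sat φ s

/-- `φ` is true at all states of all models of the class `𝓜`. -/
def Valid {L : Lang} {Ag P : Type u} (𝓜 : Set (Model Ag P)) (φ : Formula L Ag P) : Prop :=
  ∀ M ∈ 𝓜, ∀ s : M.W, M.Sat φ s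

/-- The system with base `b` for the language `L` is strongly complete with respect to `𝓜`. -/
def StronglyComplete (b : Base) (L : Lang) {Ag P : Type u} (𝓜 : Set (Model Ag P)) : Prop :=
  ∀ (Φ : Set (Formula L Ag P)) (φ : Formula L Ag P), Entails 𝓜 Φ φ → Derivable b Φ φ

/-- The system with base `b` for the language `L` is weakly complete with respect to `𝓜`. -/
def WeaklyComplete (b : Base) (L : Lang) {Ag P : Type u} (𝓜 : Set (Model Ag P)) : Prop :=
  ∀ φ : Formula L Ag P, Valid 𝓜 φ → Provable b φ

/-- The class of all models. -/
def allModels (Ag P : Type u) : Set (Model Ag P) := Set.univ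

/-- The class of all symmetric models. -/
def symmetricModels (Ag P : Type u) : Set (Model Ag P) := {M | M.IsSymmetric}

end WeightedEL

namespace WeightedEL

open Formula

section Canonical

variable {L : Lang} {Ag P : Type u} {b : Base}

/-! ### Derivations from assumptions -/

/-! Letting each agent be its own single ability turns any Kripke model into a weighted one, in
which `D_G` is the box of the intersection of the relations of `G` (`kripkeModel`). It remains to
build canonical Kripke models. For `D`, intersections of canonical relations may be too large. So
each maximal consistent set occurs in one copy per group `H`, and only agents in `H` have access to
a copy tagged `H`: an edge shared by all of `G` then forces `G ⊆ H`, and `groupRel` transfers `D_G`.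
Witnesses for `K_a` and `D_G` are tagged `{a}` and `G`. For `C`, compactness fails. Edges therefore
transmit only formulas of a finite closed set `S`, while the states remain full maximal consistent
sets. Truth of `C_G φ` then depends only on the part of a state in `S`, so a formula defines it
(`exists_defining_formula`), and the induction rule applies to that formula. The truth lemma
`canonicalModel_sat` covers both cases; without `C`, `S` may be everything. Tags would destroy
symmetry, so `KB` uses the untagged canonical model. -/

theorem Provable.of_tautology (π : PropFormula ℕ) (hπ : π.IsTautology)
    (σ : ℕ → Formula L Ag P) : Provable b (π.subst σ) :=
  .PC _ ⟨π, σ, hπ, rfl⟩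

theorem provable_imp_self (φ : Formula L Ag P) : Provable b (imp φ φ) :=
  Provable.of_tautology (.imp (.var 0) (.var 0)) (fun _ h => h) (fun _ => φ)

theorem provable_weaken (φ ψ : Formula L Ag P) : Provable b (imp φ (imp ψ φ)) :=
  Provable.of_tautology (.imp (.var 0) (.imp (.var 1) (.var 0))) (fun _ h _ => h)
    (fun n => [φ, ψ].getD n φ)

theorem provable_imp_distrib (φ ψ χ : Formula L Ag P) :
    Provable b (imp (imp φ (imp ψ χ)) (imp (imp φ ψ) (imp φ χ))) :=
  Provable.of_tautology (.imp (.imp (.var 0) (.imp (.var 1) (.var 2)))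
    (.imp (.imp (.var 0) (.var 1)) (.imp (.var 0) (.var 2)))) (fun _ h h' x => h x (h' x))
    (fun n => [φ, ψ, χ].getD n φ)

theorem provable_imp_distrib_of_imp (σ φ ψ χ : Formula L Ag P) :
    Provable b (imp (imp φ (imp ψ χ)) (imp (imp σ φ) (imp (imp σ ψ) (imp σ χ)))) :=
  Provable.of_tautology (.imp (.imp (.var 0) (.imp (.var 1) (.var 2)))
    (.imp (.imp (.var 3) (.var 0)) (.imp (.imp (.var 3) (.var 1)) (.imp (.var 3) (.var 2)))))
    (fun _ h h' h'' x => h (h' x) (h'' x))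
    (fun n => [φ, ψ, χ, σ].getD n φ)

theorem provable_imp_mono (σ φ ψ : Formula L Ag P) :
    Provable b (imp (imp φ ψ) (imp φ (imp σ ψ))) :=
  Provable.of_tautology (.imp (.imp (.var 0) (.var 1)) (.imp (.var 0) (.imp (.var 2) (.var 1))))
    (fun _ h x _ => h x) (fun n => [φ, ψ, σ].getD n φ)

theorem provable_cases (φ ψ : Formula L Ag P) :
    Provable b (imp (imp ψ φ) (imp (imp (neg ψ) φ) φ)) :=
  Provable.of_tautology (.imp (.imp (.var 0) (.var 1)) (.imp (.imp (.neg (.var 0)) (.var 1))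
    (.var 1))) (fun _ h h' => (Classical.em _).elim h h') (fun n => [ψ, φ].getD n φ)

theorem provable_absurd (φ ψ : Formula L Ag P) : Provable b (imp (neg ψ) (imp ψ φ)) :=
  Provable.of_tautology (.imp (.neg (.var 0)) (.imp (.var 0) (.var 1))) (fun _ h h' => (h h').elim)
    (fun n => [ψ, φ].getD n φ)

/-- Hilbert-style derivations from assumptions, with modus ponens as the only rule. -/
inductive Der (b : Base) (Φ : Set (Formula L Ag P)) : Formula L Ag P → Prop
  | hyp {φ} : φ ∈ Φ → Der b Φ φ
  | thm {φ} : Provable b φ → Der b Φ φ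
  | mp {φ ψ} : Der b Φ φ → Der b Φ (imp φ ψ) → Der b Φ ψ

theorem provable_foldr (l : List (Formula L Ag P)) (φ : Formula L Ag P) (h : Provable b φ) :
    Provable b (l.foldr imp φ) := by
  induction l with
  | nil => exact h
  | cons σ l ih => exact .MP _ _ ih (provable_weaken _ _)

theorem provable_foldr_imp (l : List (Formula L Ag P)) (φ ψ : Formula L Ag P) :
    Provable b (imp (l.foldr imp (imp φ ψ)) (imp (l.foldr imp φ) (l.foldr imp ψ))) := by
  induction l with
  | nil => exact provable_imp_self _
  | cons σ l ih => exact .MP _ _ ih (provable_imp_distrib_of_imp _ _ _ _)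

theorem provable_foldr_append (l l' : List (Formula L Ag P)) (φ : Formula L Ag P)
    (h : Provable b (l.foldr imp φ)) : Provable b (l.foldr imp (l'.foldr imp φ)) := by
  have h1 : Provable b (imp φ (l'.foldr imp φ)) := by
    induction l' with
    | nil => exact provable_imp_self _
    | cons σ l' ih => exact .MP _ _ ih (provable_imp_mono _ _ _)
  exact .MP _ _ h (.MP _ _ (provable_foldr _ _ h1) (provable_foldr_imp _ _ _))

theorem Der.derivable {Φ : Set (Formula L Ag P)} {φ : Formula L Ag P} (h : Der b Φ φ) :
    Derivable b Φ φ := by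
  induction h with
  | @hyp φ h => exact ⟨[φ], by simpa using h, provable_imp_self _⟩
  | thm h => exact ⟨[], by simp, h⟩
  | @mp φ ψ _ _ ih ih' =>
    obtain ⟨l, hl, h⟩ := ih
    obtain ⟨l', hl', h'⟩ := ih'
    refine ⟨l ++ l', ?_, ?_⟩
    · intro ψ hψ
      exact (List.mem_append.1 hψ).elim (hl ψ) (hl' ψ)
    · rw [List.foldr_append]
      have h1 := provable_foldr_append l l' φ h
      have h2 := provable_foldr l _ h'
      exact .MP _ _ h1 (.MP _ _ (.MP _ _ h2 (.MP _ _ (provable_foldr l _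
        (provable_foldr_imp l' φ ψ)) (provable_foldr_imp _ _ _))) (provable_foldr_imp _ _ _))

theorem Der.deduction {Φ : Set (Formula L Ag P)} {ψ φ : Formula L Ag P}
    (h : Der b (insert ψ Φ) φ) : Der b Φ (imp ψ φ) := by
  induction h with
  | hyp h =>
    rcases h with rfl | h
    · exact .thm (provable_imp_self _)
    · exact .mp (.hyp h) (.thm (provable_weaken _ _))
  | thm h => exact .mp (.thm h) (.thm (provable_weaken _ _))
  | mp _ _ ih ih' => exact .mp ih (.mp ih' (.thm (provable_imp_distrib _ _ _)))

theorem Der.mono {Φ Ψ : Set (Formula L Ag P)} {φ : Formula L Ag P} (h : Der b Φ φ) (hΦ : Φ ⊆ Ψ) :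
    Der b Ψ φ := by
  induction h with
  | hyp h => exact .hyp (hΦ h)
  | thm h => exact .thm h
  | mp _ _ ih ih' => exact .mp ih ih'

theorem Der.of_sUnion {c : Set (Set (Formula L Ag P))} (hc : IsChain (· ⊆ ·) c)
    (hne : c.Nonempty) {φ : Formula L Ag P} (h : Der b (⋃₀ c) φ) : ∃ Φ ∈ c, Der b Φ φ := by
  induction h with
  | hyp h =>
    obtain ⟨Φ, hΦ, h⟩ := h
    exact ⟨Φ, hΦ, .hyp h⟩
  | thm h =>
    obtain ⟨Φ, hΦ⟩ := hne
    exact ⟨Φ, hΦ, .thm h⟩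
  | mp _ _ ih ih' =>
    obtain ⟨Φ, hΦ, h⟩ := ih
    obtain ⟨Ψ, hΨ, h'⟩ := ih'
    rcases hc.total hΦ hΨ with hs | hs
    · exact ⟨Ψ, hΨ, .mp (h.mono hs) h'⟩
    · exact ⟨Φ, hΦ, .mp h (h'.mono hs)⟩

/-! ### Maximal consistent sets -/

/-- Maximal consistent sets of formulas. -/
structure IsMaxConsistent (b : Base) (Γ : Set (Formula L Ag P)) : Prop where
  thm {φ} : Provable b φ → φ ∈ Γ
  mp {φ ψ} : imp φ ψ ∈ Γ → φ ∈ Γ → ψ ∈ Γ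
  neg_mem {φ} : neg φ ∈ Γ ↔ φ ∉ Γ

/-- Lindenbaum's lemma. Zorn is applied to the sets that do not derive `φ`; by maximality and the
deduction theorem every `ψ` outside such a set satisfies `Γ ⊢ ψ → φ`, so omitting both `ψ` and its
negation would yield `φ` by cases. -/
theorem exists_isMaxConsistent {Φ : Set (Formula L Ag P)} {φ : Formula L Ag P} (h : ¬ Der b Φ φ) :
    ∃ Γ, IsMaxConsistent b Γ ∧ Φ ⊆ Γ ∧ φ ∉ Γ := by
  obtain ⟨Γ, hΦ, hΓ⟩ := zorn_subset_nonempty {Ψ : Set (Formula L Ag P) | ¬ Der b Ψ φ}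
    (fun c hc hch hne => ⟨⋃₀ c, fun hd => by
      obtain ⟨Ψ, hΨ, hd⟩ := Der.of_sUnion hch hne hd
      exact hc hΨ hd, fun s hs => Set.subset_sUnion_of_mem hs⟩) Φ h
  have hφ : ¬ Der b Γ φ := hΓ.prop
  have key : ∀ ψ, ψ ∉ Γ → Der b Γ (imp ψ φ) := fun ψ hψ => by
    by_contra hn
    exact hψ (hΓ.le_of_ge (y := insert ψ Γ) (fun hd => hn hd.deduction)
      (Set.subset_insert _ _) (Set.mem_insert _ _))
  have closed : ∀ ψ, Der b Γ ψ → ψ ∈ Γ := fun ψ hψ => by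
    by_contra hn
    exact hφ (.mp hψ (key ψ hn))
  refine ⟨Γ, ⟨fun h => closed _ (.thm h), fun h h' => closed _ (.mp (.hyp h') (.hyp h)), ?_⟩, hΦ,
    fun h => hφ (.hyp h)⟩
  intro ψ
  constructor
  · intro hn hp
    exact hφ (.mp (.hyp hp) (.mp (.hyp hn) (.thm (provable_absurd _ _))))
  · intro hp
    by_contra hn
    exact hφ (.mp (key _ hn) (.mp (key _ hp) (.thm (provable_cases _ _))))

namespace IsMaxConsistent

variable {Γ : Set (Formula L Ag P)} (hΓ : IsMaxConsistent b Γ)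
include hΓ

theorem mp_thm {φ ψ : Formula L Ag P} (h : Provable b (imp φ ψ)) (hφ : φ ∈ Γ) : ψ ∈ Γ :=
  hΓ.mp (hΓ.thm h) hφ

theorem imp_mem {φ ψ : Formula L Ag P} : imp φ ψ ∈ Γ ↔ (φ ∈ Γ → ψ ∈ Γ) := by
  refine ⟨hΓ.mp, fun h => ?_⟩
  by_cases hφ : φ ∈ Γ
  · exact hΓ.mp_thm (provable_weaken _ _) (h hφ)
  · exact hΓ.mp_thm (provable_absurd _ _) (hΓ.neg_mem.2 hφ)

theorem conj_mem {φ ψ : Formula L Ag P} : conj φ ψ ∈ Γ ↔ φ ∈ Γ ∧ ψ ∈ Γ := by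
  rw [conj, hΓ.neg_mem, hΓ.imp_mem, hΓ.neg_mem]; tauto

theorem iff_mem {φ ψ : Formula L Ag P} : Formula.iff φ ψ ∈ Γ ↔ (φ ∈ Γ ↔ ψ ∈ Γ) := by
  rw [Formula.iff, hΓ.conj_mem, hΓ.imp_mem, hΓ.imp_mem]; tauto

theorem bigConj_mem (φ : Formula L Ag P) (l : List (Formula L Ag P)) :
    bigConj φ l ∈ Γ ↔ ∀ ψ ∈ φ :: l, ψ ∈ Γ := by
  induction l generalizing φ with
  | nil => simp [bigConj]
  | cons ψ l ih => simp [bigConj, hΓ.conj_mem, ih]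

theorem everyone_mem {G : AgentGroup Ag} {φ : Formula L Ag P} :
    everyone G φ ∈ Γ ↔ ∀ a ∈ G.1, know a φ ∈ Γ := by
  have h : (members G).head (members_ne_nil G) :: (members G).tail = members G :=
    List.cons_head_tail _
  rw [everyone, hΓ.bigConj_mem, ← List.map_cons (f := fun a => know a φ), h]
  simp [members]

end IsMaxConsistent

/-- This allows theorems of the system to be obtained by reasoning about membership instead of by
writing out derivations. -/
theorem provable_of_forall_mem {φ : Formula L Ag P}
    (h : ∀ Γ : Set (Formula L Ag P), IsMaxConsistent b Γ → φ ∈ Γ) : Provable b φ := by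
  by_contra hφ
  have hd : ¬ Der b ∅ φ := fun hd => by
    obtain ⟨l, hl, hd⟩ := hd.derivable
    cases l with
    | nil => exact hφ hd
    | cons ψ l => exact hl ψ (by simp)
  obtain ⟨Γ, hΓ, -, hn⟩ := exists_isMaxConsistent hd
  exact hn (h Γ hΓ)

/-- Every state that refutes `□ φ`, for a normal operator `□`, has a successor refuting `φ`. -/
theorem IsMaxConsistent.exists_not_mem {Γ : Set (Formula L Ag P)} (hΓ : IsMaxConsistent b Γ)
    (box : Formula L Ag P → Formula L Ag P) (nec : ∀ φ, Provable b φ → Provable b (box φ))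
    (ax : ∀ φ ψ, Provable b (imp (box (imp φ ψ)) (imp (box φ) (box ψ))))
    {φ : Formula L Ag P} (hφ : box φ ∉ Γ) :
    ∃ Δ, IsMaxConsistent b Δ ∧ (∀ ψ, box ψ ∈ Γ → ψ ∈ Δ) ∧ φ ∉ Δ := by
  -- By normality, the formulas whose box lies in `Γ` are closed under derivation, so deriving `φ`
  -- from them would put `box φ` in `Γ`.
  refine exists_isMaxConsistent (Φ := {ψ | box ψ ∈ Γ}) fun hd => hφ ?_
  clear hφ
  induction hd with
  | hyp h => exact h
  | thm h => exact hΓ.thm (nec _ h)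
  | mp _ _ ih ih' => exact hΓ.mp (hΓ.mp_thm (ax _ _) ih') ih

theorem IsMaxConsistent.dist_of_know {Γ : Set (Formula L Ag P)} (hΓ : IsMaxConsistent b Γ)
    (hD : L.hasD = true) {a : Ag} {G : AgentGroup Ag} (ha : a ∈ G.1) {φ : Formula L Ag P}
    (h : know a φ ∈ Γ) : dist hD G φ ∈ Γ :=
  hΓ.mp_thm (.D2 hD (AgentGroup.single a) G (by simpa [AgentGroup.single] using ha) φ)
    ((hΓ.iff_mem.1 (hΓ.thm (.D1 hD a φ))).2 h)

/-- Necessitation for `D_G` is not a rule; it follows from `N` for some member of `G`, using `D1`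
and `D2`. -/
theorem provable_dist (hD : L.hasD = true) (G : AgentGroup Ag) (φ : Formula L Ag P)
    (h : Provable b φ) : Provable b (dist hD G φ) := by
  obtain ⟨a, ha⟩ := G.2
  exact provable_of_forall_mem fun Γ hΓ => hΓ.dist_of_know hD ha (hΓ.thm (.N a φ h))

theorem provable_imp_everyone {G : AgentGroup Ag} {φ ψ : Formula L Ag P}
    (h : ∀ a ∈ G.1, ∀ Γ Δ : Set (Formula L Ag P), IsMaxConsistent b Γ → IsMaxConsistent b Δ →
      (∀ χ, know a χ ∈ Γ → χ ∈ Δ) → φ ∈ Γ → ψ ∈ Δ) :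
    Provable b (imp φ (everyone G ψ)) := by
  refine provable_of_forall_mem fun Γ hΓ => hΓ.imp_mem.2 fun hφ => hΓ.everyone_mem.2 fun a ha => ?_
  by_contra hn
  obtain ⟨Δ, hΔ, hR, hψ⟩ := hΓ.exists_not_mem (know a) (.N a) (.axK a) hn
  exact hψ (h a ha Γ Δ hΓ hΔ hR hφ)

/-- A set of maximal consistent sets that depends only on finitely many formulas is defined by a
formula. -/
theorem exists_defining_formula [Nonempty (Formula L Ag P)] {S : Set (Formula L Ag P)}
    (hS : S.Finite) (X : Set (Set (Formula L Ag P)))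
    (hX : ∀ Γ Δ, (∀ φ ∈ S, φ ∈ Γ ↔ φ ∈ Δ) → IsMaxConsistent b Γ → IsMaxConsistent b Δ →
      Γ ∈ X → Δ ∈ X) :
    ∃ χ, ∀ Γ, IsMaxConsistent b Γ → (χ ∈ Γ ↔ Γ ∈ X) := by
  induction S, hS using Set.Finite.induction_on generalizing X with
  | empty =>
    obtain ⟨φ⟩ := ‹Nonempty (Formula L Ag P)›
    -- With no formulas to distinguish them, `X` contains either all maximal consistent sets or
    -- none.
    by_cases h : ∃ Γ ∈ X, IsMaxConsistent b Γ
    · obtain ⟨Γ, hΓ, hm⟩ := h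
      exact ⟨imp φ φ, fun Δ hΔ => iff_of_true (hΔ.thm (provable_imp_self _))
        (hX Γ Δ (by simp) hm hΔ hΓ)⟩
    · exact ⟨neg (imp φ φ), fun Δ hΔ => iff_of_false
        (fun h' => hΔ.neg_mem.1 h' (hΔ.thm (provable_imp_self _))) fun h' => h ⟨Δ, h', hΔ⟩⟩
  | @insert σ S _ _ ih =>
    -- The members of `X` are split by whether they contain `σ`. Each half, saturated under
    -- agreement on `S`, is definable by induction, and the case distinction on `σ` recovers `X`.
    have aux : ∀ Q : Set (Formula L Ag P) → Prop, ∃ χ, ∀ Γ, IsMaxConsistent b Γ →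
        (χ ∈ Γ ↔ ∃ Γ' ∈ X, IsMaxConsistent b Γ' ∧ Q Γ' ∧ ∀ φ ∈ S, φ ∈ Γ' ↔ φ ∈ Γ) := fun Q =>
      ih {Γ | ∃ Γ' ∈ X, IsMaxConsistent b Γ' ∧ Q Γ' ∧ ∀ φ ∈ S, φ ∈ Γ' ↔ φ ∈ Γ} <| by
        rintro Γ Δ h - - ⟨Γ', h1, h2, h3, h4⟩
        exact ⟨Γ', h1, h2, h3, fun φ hφ => (h4 φ hφ).trans (h φ hφ)⟩
    obtain ⟨χ, hχ⟩ := aux (σ ∈ ·)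
    obtain ⟨ξ, hξ⟩ := aux (σ ∉ ·)
    refine ⟨conj (imp σ χ) (imp (neg σ) ξ), fun Γ hΓ => ?_⟩
    rw [hΓ.conj_mem, hΓ.imp_mem, hΓ.imp_mem, hΓ.neg_mem, hχ Γ hΓ, hξ Γ hΓ]
    constructor
    · rintro ⟨h1, h2⟩
      by_cases hσ : σ ∈ Γ
      · obtain ⟨Γ', h3, h4, h5, h6⟩ := h1 hσ
        exact hX Γ' Γ (by simpa [h5, hσ] using h6) h4 hΓ h3
      · obtain ⟨Γ', h3, h4, h5, h6⟩ := h2 hσ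
        exact hX Γ' Γ (by simpa [h5, hσ] using h6) h4 hΓ h3
    · intro h
      exact ⟨fun hσ => ⟨Γ, h, hΓ, hσ, fun _ _ => Iff.rfl⟩,
        fun hσ => ⟨Γ, h, hΓ, hσ, fun _ _ => Iff.rfl⟩⟩

/-! ### Closed sets of formulas -/

/-- Sets of formulas closed under subformulas and under unfolding common knowledge. -/
structure IsClosedSet (S : Set (Formula L Ag P)) : Prop where
  of_neg {φ} : neg φ ∈ S → φ ∈ S
  of_imp {φ ψ} : imp φ ψ ∈ S → φ ∈ S ∧ ψ ∈ S
  of_know {a φ} : know a φ ∈ S → φ ∈ S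
  of_dist {hD G φ} : dist hD G φ ∈ S → φ ∈ S
  of_common {hC G φ} : common hC G φ ∈ S →
    φ ∈ S ∧ ∀ a ∈ G.1, know a φ ∈ S ∧ know a (common hC G φ) ∈ S

theorem isClosedSet_univ : IsClosedSet (Set.univ : Set (Formula L Ag P)) := by
  constructor <;> simp

theorem exists_finite_isClosedSet (φ : Formula L Ag P) :
    ∃ S : Set (Formula L Ag P), S.Finite ∧ IsClosedSet S ∧ φ ∈ S := by
  induction φ with
  | atom p => exact ⟨{atom p}, Set.finite_singleton _, by constructor <;> simp, rfl⟩
  | neg φ ih =>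
    obtain ⟨S, hf, hS, hφ⟩ := ih
    refine ⟨insert (neg φ) S, hf.insert _, ?_, Set.mem_insert _ _⟩
    constructor <;> simp only [Set.mem_insert_iff, reduceCtorEq, false_or, neg.injEq]
    · rintro ψ (rfl | h)
      exacts [.inr hφ, .inr (hS.of_neg h)]
    · exact fun h => ⟨.inr (hS.of_imp h).1, .inr (hS.of_imp h).2⟩
    · exact fun h => .inr (hS.of_know h)
    · exact fun h => .inr (hS.of_dist h)
    · exact fun h => ⟨.inr (hS.of_common h).1, (hS.of_common h).2⟩
  | imp φ ψ ih ih' =>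
    obtain ⟨S, hf, hS, hφ⟩ := ih
    obtain ⟨T, hg, hT, hψ⟩ := ih'
    refine ⟨insert (imp φ ψ) (S ∪ T), (hf.union hg).insert _, ?_, Set.mem_insert _ _⟩
    constructor <;> simp only [Set.mem_insert_iff, Set.mem_union, reduceCtorEq, false_or,
      imp.injEq]
    · rintro ξ (h | h)
      exacts [.inr (.inl (hS.of_neg h)), .inr (.inr (hT.of_neg h))]
    · rintro ξ ζ (⟨rfl, rfl⟩ | h | h)
      · exact ⟨.inr (.inl hφ), .inr (.inr hψ)⟩
      · exact ⟨.inr (.inl (hS.of_imp h).1), .inr (.inl (hS.of_imp h).2)⟩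
      · exact ⟨.inr (.inr (hT.of_imp h).1), .inr (.inr (hT.of_imp h).2)⟩
    · rintro a ξ (h | h)
      exacts [.inr (.inl (hS.of_know h)), .inr (.inr (hT.of_know h))]
    · rintro hD G ξ (h | h)
      exacts [.inr (.inl (hS.of_dist h)), .inr (.inr (hT.of_dist h))]
    · rintro hC G ξ (h | h)
      · exact ⟨.inr (.inl (hS.of_common h).1), fun a ha =>
          ⟨.inl ((hS.of_common h).2 a ha).1, .inl ((hS.of_common h).2 a ha).2⟩⟩
      · exact ⟨.inr (.inr (hT.of_common h).1), fun a ha =>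
          ⟨.inr ((hT.of_common h).2 a ha).1, .inr ((hT.of_common h).2 a ha).2⟩⟩
  | know a φ ih =>
    obtain ⟨S, hf, hS, hφ⟩ := ih
    refine ⟨insert (know a φ) S, hf.insert _, ?_, Set.mem_insert _ _⟩
    constructor <;> simp only [Set.mem_insert_iff, reduceCtorEq, false_or, know.injEq]
    · exact fun h => .inr (hS.of_neg h)
    · exact fun h => ⟨.inr (hS.of_imp h).1, .inr (hS.of_imp h).2⟩
    · rintro a ψ (⟨rfl, rfl⟩ | h)
      exacts [.inr hφ, .inr (hS.of_know h)]
    · exact fun h => .inr (hS.of_dist h)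
    · exact fun h => ⟨.inr (hS.of_common h).1, fun a ha =>
        ⟨.inr ((hS.of_common h).2 a ha).1, .inr ((hS.of_common h).2 a ha).2⟩⟩
  | common hC G φ ih =>
    obtain ⟨S, hf, hS, hφ⟩ := ih
    -- The formulas `K_a φ` and `K_a C_G φ` must lie in the set so that edges pass on both `φ` and
    -- `C_G φ`; finitely many suffice since `G` is finite.
    refine ⟨insert (common hC G φ) S ∪ ((fun a => know a φ) '' G.1 ∪
      (fun a => know a (common hC G φ)) '' G.1), (hf.insert _).union
      ((G.1.finite_toSet.image _).union (G.1.finite_toSet.image _)), ?_,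
      .inl (Set.mem_insert _ _)⟩
    constructor <;> simp only [Set.mem_union, Set.mem_insert_iff, Set.mem_image, reduceCtorEq,
      false_or, or_false, and_false, exists_false, know.injEq, common.injEq, Finset.mem_coe]
    · exact fun h => .inl (.inr (hS.of_neg h))
    · exact fun h => ⟨.inl (.inr (hS.of_imp h).1), .inl (.inr (hS.of_imp h).2)⟩
    · rintro a ψ (h | ⟨_, _, _, rfl⟩ | ⟨_, _, _, rfl⟩)
      exacts [.inl (.inr (hS.of_know h)), .inl (.inr hφ), .inl (.inl rfl)]
    · exact fun h => .inl (.inr (hS.of_dist h))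
    · rintro _ H ψ (⟨rfl, rfl⟩ | h)
      · exact ⟨.inl (.inr hφ), fun a ha => ⟨.inr (.inl ⟨a, ha, rfl, rfl⟩),
          .inr (.inr ⟨a, ha, rfl, rfl, rfl⟩)⟩⟩
      · exact ⟨.inl (.inr (hS.of_common h).1), fun a ha =>
          ⟨.inl ((hS.of_common h).2 a ha).1, .inl ((hS.of_common h).2 a ha).2⟩⟩
  | dist hD G φ ih =>
    obtain ⟨S, hf, hS, hφ⟩ := ih
    refine ⟨insert (dist hD G φ) S, hf.insert _, ?_, Set.mem_insert _ _⟩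
    constructor <;> simp only [Set.mem_insert_iff, reduceCtorEq, false_or, dist.injEq]
    · exact fun h => .inr (hS.of_neg h)
    · exact fun h => ⟨.inr (hS.of_imp h).1, .inr (hS.of_imp h).2⟩
    · exact fun h => .inr (hS.of_know h)
    · rintro _ G ψ (⟨rfl, rfl⟩ | h)
      exacts [.inr hφ, .inr (hS.of_dist h)]
    · exact fun h => ⟨.inr (hS.of_common h).1, (hS.of_common h).2⟩

/-! ### Models from Kripke frames -/

/-- The weighted model of a Kripke model with an accessibility relation for each agent. -/
def kripkeModel (W : Type u) [hW : Nonempty W] (R : Ag → W → W → Prop) (ν : W → Set P) :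
    Model Ag P where
  W := W
  nonempty := hW
  A := Ag
  E s t := {a | R a s t}
  C a := {a}
  ν := ν

section kripkeModel

variable (W : Type u) [Nonempty W] (R : Ag → W → W → Prop) (ν : W → Set P)

theorem kripkeModel_sat_know (a : Ag) (φ : Formula L Ag P) (s : W) :
    (kripkeModel W R ν).Sat (know a φ) s ↔ ∀ t : W, R a s t → (kripkeModel W R ν).Sat φ t :=
  forall_congr' fun _ => imp_congr_left Set.singleton_subset_iff

theorem kripkeModel_sat_dist (hD : L.hasD = true) (G : AgentGroup Ag) (φ : Formula L Ag P) (s : W) :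
    (kripkeModel W R ν).Sat (dist hD G φ) s ↔
      ∀ t : W, (∀ a ∈ G.1, R a s t) → (kripkeModel W R ν).Sat φ t :=
  forall_congr' fun _ => imp_congr_left <| Set.iUnion₂_subset_iff.trans <|
    forall₂_congr fun _ _ => Set.singleton_subset_iff

theorem kripkeModel_everyoneKnows (G : AgentGroup Ag) (X : W → Prop) (s : W) :
    (kripkeModel W R ν).everyoneKnows G X s ↔ ∀ a ∈ G.1, ∀ t : W, R a s t → X t :=
  forall₂_congr fun _ _ => forall_congr' fun _ => imp_congr_left Set.singleton_subset_iff

end kripkeModel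

/-! ### The canonical model -/

/-- The states of the canonical model: a maximal consistent set, and the group of the agents that
have access to the state. -/
abbrev CanonicalState (b : Base) (L : Lang) (Ag P : Type u) : Type u :=
  {Γ : Set (Formula L Ag P) // IsMaxConsistent b Γ} × AgentGroup Ag

/-- The canonical accessibility relation for the group `H`, relative to the formulas in `S`. -/
def groupRel (S : Set (Formula L Ag P)) (H : AgentGroup Ag) (Γ Δ : Set (Formula L Ag P)) : Prop :=
  (∀ a ∈ H.1, ∀ φ, know a φ ∈ S → know a φ ∈ Γ → φ ∈ Δ) ∧
    ∀ hD G φ, G.1 ⊆ H.1 → dist hD G φ ∈ S → dist hD G φ ∈ Γ → φ ∈ Δ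

theorem groupRel_congr {S : Set (Formula L Ag P)} {H : AgentGroup Ag}
    {Γ Γ' Δ : Set (Formula L Ag P)} (h : ∀ φ ∈ S, φ ∈ Γ ↔ φ ∈ Γ') (hR : groupRel S H Γ' Δ) :
    groupRel S H Γ Δ :=
  ⟨fun a ha φ hS hφ => hR.1 a ha φ hS ((h _ hS).1 hφ),
    fun hD G φ hG hS hφ => hR.2 hD G φ hG hS ((h _ hS).1 hφ)⟩

/-- For `G ⊆ {a}`, `D2` followed by `D1` reduces `D_G` to `K_a`. -/
theorem groupRel_single (S : Set (Formula L Ag P)) {a : Ag} {Γ Δ : Set (Formula L Ag P)}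
    (hΓ : IsMaxConsistent b Γ) (h : ∀ φ, know a φ ∈ Γ → φ ∈ Δ) :
    groupRel S (AgentGroup.single a) Γ Δ := by
  refine ⟨fun c hc φ _ hφ => ?_, fun hD G φ hG _ hφ => ?_⟩
  · obtain rfl : c = a := by simpa [AgentGroup.single] using hc
    exact h φ hφ
  · exact h φ ((hΓ.iff_mem.1 (hΓ.thm (.D1 hD a φ))).1 (hΓ.mp_thm (.D2 hD G _ hG φ) hφ))

theorem groupRel_of_dist (S : Set (Formula L Ag P)) (hD : L.hasD = true) {H : AgentGroup Ag}
    {Γ Δ : Set (Formula L Ag P)} (hΓ : IsMaxConsistent b Γ)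
    (h : ∀ φ, dist hD H φ ∈ Γ → φ ∈ Δ) : groupRel S H Γ Δ :=
  ⟨fun _ ha φ _ hφ => h φ (hΓ.dist_of_know hD ha hφ),
    fun _ G φ hG _ hφ => h φ (hΓ.mp_thm (.D2 hD G H hG φ) hφ)⟩

/-- The canonical model relative to the formulas in `S`. -/
def canonicalModel (b : Base) (S : Set (Formula L Ag P)) [Nonempty (CanonicalState b L Ag P)] :
    Model Ag P :=
  kripkeModel (CanonicalState b L Ag P) (fun a s t => a ∈ t.2.1 ∧ groupRel S t.2 s.1.1 t.1.1)
    (fun s => {p | atom p ∈ s.1.1})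

variable [Nonempty (CanonicalState b L Ag P)]

theorem canonicalModel_common {S : Set (Formula L Ag P)} (hS : IsClosedSet S) (hf : S.Finite)
    {hC : L.hasC = true} {G : AgentGroup Ag} {φ : Formula L Ag P} (hφ : common hC G φ ∈ S)
    (ih : ∀ s : CanonicalState b L Ag P, (canonicalModel b S).Sat φ s ↔ φ ∈ s.1.1)
    (s : CanonicalState b L Ag P) :
    (canonicalModel b S).Sat (common hC G φ) s ↔ common hC G φ ∈ s.1.1 := by
  have step : ∀ (n : ℕ) (s : CanonicalState b L Ag P),
      (((canonicalModel b S).everyoneKnows G)^[n + 1] ((canonicalModel b S).Sat φ)) s ↔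
      ∀ a ∈ G.1, ∀ t : CanonicalState b L Ag P, a ∈ t.2.1 ∧ groupRel S t.2 s.1.1 t.1.1 →
        (((canonicalModel b S).everyoneKnows G)^[n] ((canonicalModel b S).Sat φ)) t := by
    intro n s
    rw [Function.iterate_succ_apply']
    exact kripkeModel_everyoneKnows _ _ _ _ _ _
  constructor
  · intro h
    have : Nonempty (Formula L Ag P) := ⟨φ⟩
    -- `χ` defines semantic truth of `C_G φ`: all `G`-successors satisfy every `E_G^n φ`, where `n =
    -- 0` is included because one step has already been taken.
    obtain ⟨χ, hχ⟩ := exists_defining_formula (b := b) (S := S) hf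
      {Γ | ∀ n, ∀ a ∈ G.1, ∀ t : CanonicalState b L Ag P, a ∈ t.2.1 ∧ groupRel S t.2 Γ t.1.1 →
        (((canonicalModel b S).everyoneKnows G)^[n] ((canonicalModel b S).Sat φ)) t}
      (fun Γ Δ hΓΔ _ _ hX n a ha t ht => hX n a ha t ⟨ht.1, groupRel_congr hΓΔ ht.2⟩)
    refine s.1.2.mp_thm (.C2 hC G χ φ (provable_imp_everyone ?_))
      ((hχ _ s.1.2).2 fun n => (step n s).1 (h (n + 1) (Nat.succ_pos n)))
    intro a ha Γ Δ hΓ hΔ hR hm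
    have hX := (hχ Γ hΓ).1 hm
    -- The copy of `Δ` tagged `{a}` is a successor of `Γ` in the model, so it inherits every `E_G^n
    -- φ`.
    have ht : ∀ n, (((canonicalModel b S).everyoneKnows G)^[n] ((canonicalModel b S).Sat φ))
        (⟨⟨Δ, hΔ⟩, AgentGroup.single a⟩ : CanonicalState b L Ag P) := fun n =>
      hX n a ha ⟨⟨Δ, hΔ⟩, AgentGroup.single a⟩
        ⟨by simp [AgentGroup.single], groupRel_single S hΓ hR⟩
    exact hΔ.conj_mem.2 ⟨(hχ Δ hΔ).2 fun n => (step n _).1 (ht (n + 1)), (ih _).1 (ht 0)⟩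
  · intro h n hn
    obtain ⟨n, rfl⟩ : ∃ m, n = m + 1 := ⟨n - 1, by omega⟩
    have hsucc : ∀ s t : CanonicalState b L Ag P, common hC G φ ∈ s.1.1 → ∀ a ∈ G.1,
        a ∈ t.2.1 ∧ groupRel S t.2 s.1.1 t.1.1 → φ ∈ t.1.1 ∧ common hC G φ ∈ t.1.1 := by
      intro s t hs a ha ht
      have hk := s.1.2.everyone_mem.1 (s.1.2.mp_thm (.C1 hC G φ) hs) a ha
      have hk' : ∀ ψ, Provable b (imp (conj φ (common hC G φ)) ψ) → know a ψ ∈ s.1.1 :=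
        fun ψ hψ => s.1.2.mp (s.1.2.mp_thm (.axK a _ _) (s.1.2.thm (.N a _ hψ))) hk
      exact ⟨ht.2.1 a ht.1 _ ((hS.of_common hφ).2 a ha).1 (hk' _ (provable_of_forall_mem
          fun Γ hΓ => hΓ.imp_mem.2 fun h => (hΓ.conj_mem.1 h).1)),
        ht.2.1 a ht.1 _ ((hS.of_common hφ).2 a ha).2 (hk' _ (provable_of_forall_mem
          fun Γ hΓ => hΓ.imp_mem.2 fun h => (hΓ.conj_mem.1 h).2))⟩
    clear hn
    induction n generalizing s with
    | zero =>
      rw [step]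
      exact fun a ha t ht => (ih t).2 (hsucc s t h a ha ht).1
    | succ n ihn =>
      rw [step]
      exact fun a ha t ht => ihn t (hsucc s t h a ha ht).2

/-- Truth lemma. Finiteness of `S` enters only through the clause for `C`. -/
theorem canonicalModel_sat {S : Set (Formula L Ag P)} (hS : IsClosedSet S)
    (hf : L.hasC = true → S.Finite) {φ : Formula L Ag P} (hφ : φ ∈ S)
    (s : CanonicalState b L Ag P) : (canonicalModel b S).Sat φ s ↔ φ ∈ s.1.1 := by
  induction φ generalizing s with
  | atom p => exact Iff.rfl
  | neg φ ih =>
    rw [s.1.2.neg_mem, ← ih (hS.of_neg hφ)]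
    exact Iff.rfl
  | imp φ ψ ih ih' =>
    rw [s.1.2.imp_mem, ← ih (hS.of_imp hφ).1, ← ih' (hS.of_imp hφ).2]
    exact Iff.rfl
  | know a φ ih =>
    refine (kripkeModel_sat_know _ _ _ a φ s).trans ⟨fun h => ?_, fun h t ht => ?_⟩
    · by_contra hn
      obtain ⟨Δ, hΔ, hR, hm⟩ := s.1.2.exists_not_mem (know a) (.N a) (.axK a) hn
      exact hm ((ih (hS.of_know hφ) _).1 (h ⟨⟨Δ, hΔ⟩, AgentGroup.single a⟩
        ⟨by simp [AgentGroup.single], groupRel_single S s.1.2 hR⟩))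
    · exact (ih (hS.of_know hφ) t).2 (ht.2.1 a ht.1 φ hφ h)
  | common hC G φ ih => exact canonicalModel_common hS (hf hC) hφ (ih (hS.of_common hφ).1) s
  | dist hD G φ ih =>
    refine (kripkeModel_sat_dist _ _ _ hD G φ s).trans ⟨fun h => ?_, fun h t ht => ?_⟩
    · by_contra hn
      obtain ⟨Δ, hΔ, hR, hm⟩ := s.1.2.exists_not_mem (dist hD G) (provable_dist hD G)
        (.KD hD G) hn
      exact hm ((ih (hS.of_dist hφ) _).1 (h ⟨⟨Δ, hΔ⟩, G⟩
        fun a ha => ⟨ha, groupRel_of_dist S hD s.1.2 hR⟩))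
    · obtain ⟨a, ha⟩ := G.2
      exact (ih (hS.of_dist hφ) t).2
        -- All of `G` has access to `t`, so `G` is contained in the tag of `t`; the relation for one
        -- member then already transmits `D_G`.
        ((ht a ha).2.2 hD G φ (fun c hc => (ht c hc).1) hφ h)

end Canonical

/-! ### Completeness -/

variable {L : Lang} {Ag P : Type u}

theorem stronglyComplete_allModels [Nonempty Ag] (b : Base) (hC : L.hasC = false) :
    StronglyComplete b L (allModels Ag P) := by
  intro Φ φ h
  by_contra hn
  obtain ⟨Γ, hΓ, hΦ, hφ⟩ := exists_isMaxConsistent fun hd : Der b Φ φ => hn hd.derivable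
  -- The tag is irrelevant here: it restricts only edges into a state.
  let s : CanonicalState b L Ag P := ⟨⟨Γ, hΓ⟩, AgentGroup.single (Classical.arbitrary Ag)⟩
  have : Nonempty (CanonicalState b L Ag P) := ⟨s⟩
  have truth (ψ : Formula L Ag P) : (canonicalModel b Set.univ).Sat ψ s ↔ ψ ∈ Γ :=
    canonicalModel_sat isClosedSet_univ (by simp [hC]) (Set.mem_univ ψ) s
  exact hφ ((truth φ).1 (h (canonicalModel b Set.univ) (Set.mem_univ _) s fun ψ hψ => (truth ψ).2 (hΦ hψ)))

theorem weaklyComplete_allModels [Nonempty Ag] (b : Base) :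
    WeaklyComplete b L (allModels Ag P) := by
  intro φ h
  refine provable_of_forall_mem fun Γ hΓ => ?_
  obtain ⟨S, hf, hS, hφ⟩ := exists_finite_isClosedSet φ
  let s : CanonicalState b L Ag P := ⟨⟨Γ, hΓ⟩, AgentGroup.single (Classical.arbitrary Ag)⟩
  have : Nonempty (CanonicalState b L Ag P) := ⟨s⟩
  exact (canonicalModel_sat hS (fun _ => hf) hφ s).1 (h (canonicalModel b S) (Set.mem_univ _) s)

/-- The canonical relation of `KB` is symmetric. -/
theorem know_symmetric {a : Ag} {Γ Δ : Set (Formula L Ag P)} (hΓ : IsMaxConsistent .KB Γ)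
    (hΔ : IsMaxConsistent .KB Δ) (h : ∀ φ, know a φ ∈ Γ → φ ∈ Δ) (φ : Formula L Ag P)
    (hφ : know a φ ∈ Δ) : φ ∈ Γ := by
  by_contra hn
  -- Axiom B for `¬φ` puts `¬K_a ¬¬φ` in `Δ`, while `K_a φ ∈ Δ` gives `K_a ¬¬φ ∈ Δ`.
  refine hΔ.neg_mem.1 (h _ (hΓ.mp_thm (.axB rfl a (neg φ)) (hΓ.neg_mem.2 hn))) ?_
  exact hΔ.mp (hΔ.mp_thm (.axK a _ _) (hΔ.thm (.N a _ (provable_of_forall_mem fun Θ hΘ =>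
    hΘ.imp_mem.2 fun h => hΘ.neg_mem.2 fun h' => hΘ.neg_mem.1 h' h)))) hφ

theorem stronglyComplete_symmetricModels (hC : L.hasC = false) (hD : L.hasD = false) :
    StronglyComplete .KB L (symmetricModels Ag P) := by
  intro Φ φ h
  by_contra hn
  obtain ⟨Γ, hΓ, hΦ, hφ⟩ := exists_isMaxConsistent fun hd : Der .KB Φ φ => hn hd.derivable
  have : Nonempty {Γ : Set (Formula L Ag P) // IsMaxConsistent .KB Γ} := ⟨⟨Γ, hΓ⟩⟩
  let M : Model Ag P := kripkeModel {Γ : Set (Formula L Ag P) // IsMaxConsistent .KB Γ}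
    (fun a s t => ∀ ψ, know a ψ ∈ s.1 → ψ ∈ t.1) (fun s => {p | atom p ∈ s.1})
  have hM : M.IsSymmetric := fun s t => Set.ext fun a =>
    ⟨know_symmetric s.2 t.2, know_symmetric t.2 s.2⟩
  have truth (ψ : Formula L Ag P) (s : {Γ : Set (Formula L Ag P) // IsMaxConsistent .KB Γ}) :
      M.Sat ψ s ↔ ψ ∈ s.1 := by
    induction ψ generalizing s with
    | atom p => exact Iff.rfl
    | neg ψ ih =>
      rw [s.2.neg_mem, ← ih]
      exact Iff.rfl
    | imp ψ χ ih ih' =>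
      rw [s.2.imp_mem, ← ih, ← ih']
      exact Iff.rfl
    | know a ψ ih =>
      refine (kripkeModel_sat_know _ _ _ a ψ s).trans ⟨fun h => ?_, fun h t ht => ?_⟩
      · by_contra hn
        obtain ⟨Δ, hΔ, hR, hm⟩ := s.2.exists_not_mem (know a) (.N a) (.axK a) hn
        exact hm ((ih ⟨Δ, hΔ⟩).1 (h ⟨Δ, hΔ⟩ hR))
      · exact (ih t).2 (ht ψ h)
    | common h => simp [hC] at h
    | dist h => simp [hD] at h
  exact hφ ((truth φ ⟨Γ, hΓ⟩).1 (h M hM ⟨Γ, hΓ⟩ fun ψ hψ => (truth ψ _).2 (hΦ hψ)))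

end WeightedEL

theorem mainTheorem3 (Ag P : Type u) [Finite Ag] [Nonempty Ag] [Countable P] [Infinite P] :
    WeightedEL.StronglyComplete .K WeightedEL.EL (WeightedEL.allModels Ag P) ∧
    WeightedEL.WeaklyComplete .K WeightedEL.ELC (WeightedEL.allModels Ag P) ∧
    WeightedEL.StronglyComplete .K WeightedEL.ELD (WeightedEL.allModels Ag P) ∧
    WeightedEL.WeaklyComplete .K WeightedEL.ELCD (WeightedEL.allModels Ag P) ∧
    WeightedEL.StronglyComplete .KB WeightedEL.EL (WeightedEL.symmetricModels Ag P) :=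
  ⟨WeightedEL.stronglyComplete_allModels _ rfl, WeightedEL.weaklyComplete_allModels _,
    WeightedEL.stronglyComplete_allModels _ rfl, WeightedEL.weaklyComplete_allModels _,
    WeightedEL.stronglyComplete_symmetricModels rfl rfl⟩
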